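/- There is an absolute constant $c > 0$ such that the following holds. Let $N$ be a positive integer and let $A, B \subset \{1, \ldots, N\}$ be non-empty sets of sizes $\alpha N$ and $\beta N$. Then the sumset $A+B = \{a+b : a \in A,\ b \in B\}$ contains an arithmetic progression of length at least $$\tfrac{1}{2}\exp\left( c \left(\frac{\alpha \log N}{\log(4/\beta)} \right)^{1/4} \right).$$ Here an arithmetic progression of length $k$ is a set $\{a, a+d, \ldots, a+(k-1)d\}$ of integers with $d \neq 0$. -/

import Mathlib

open scoped Pointwise

/-- `P` is an arithmetic progression of length `k` in the abelian group `G`: it can be written as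
`{a, a + d, …, a + (k - 1) d}` for some non-zero `d`. -/
def IsArithProgOfLength {G : Type*} [AddCommGroup G] (P : Set G) (k : ℕ) : Prop :=
  ∃ a d : G, d ≠ 0 ∧ P = {x | ∃ i : ℕ, i < k ∧ x = a + i • d}

/-! ### Random samples from `B` and the convolution of `A` with `B`. -/

section AlmostPeriods

variable {G : Type*} [AddCommGroup G] [DecidableEq G]

/-! Write μ for `convDens A B`: it vanishes off A + B and has mean a = |A|/|A + B| there. A random
k-tuple from B approximates μ to within η(μ + a), with total cost exponentially small in kaη², for
at least half of B^k (`card_goodSamples_ge`).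

Pigeonholing good tuples translated by 2^j d, for all j < J at once, gives a single D ≠ 0 such that
for each j some good tuple stays good after translation by 2^j D (`exists_translates_mem`). Thus
every 2^j D is an almost-period of μ. Reaching x + iD through the binary digits of i < 2^J takes at
most J steps, each losing a factor 1 - 2η, so with η = 1/(8J) a suitable x keeps μ positive along
the whole progression (`exists_forall_add_smul_mem`).

Summing costs over 2^J endpoints needs kaη² of order J, so k of order J³/α. The pigeonhole then
needs log N of order kJ log(4/β), that is J⁴ log(4/β)/α, whence the exponent 1/4. -/

/-- The proportion of the elements of `B` whose difference from `x` lies in `A`; this is the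
convolution of the indicator function of `A` with the uniform measure on `B`. -/
noncomputable def convDens (A B : Finset G) (x : G) : ℝ :=
  (∑ b ∈ B, if x - b ∈ A then (1 : ℝ) else 0) / B.card

/-- The analogue of `convDens` for a finite sequence `b` in place of the set `B`. -/
noncomputable def sampleDens (A : Finset G) {k : ℕ} (b : Fin k → G) (x : G) : ℝ :=
  (∑ i, if x - b i ∈ A then (1 : ℝ) else 0) / k

/-- The cost of a sample `b` at the point `x`: zero when `sampleDens` approximates `convDens` well
there. -/
noncomputable def sampleCost (A B : Finset G) (a η : ℝ) {k : ℕ} (b : Fin k → G) (x : G) : ℝ :=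
  if |sampleDens A b x - convDens A B x| ≤ η * (convDens A B x + a) then 0
  else convDens A B x + a + |sampleDens A b x - convDens A B x|

lemma convDens_nonneg (A B : Finset G) (x : G) : 0 ≤ convDens A B x :=
  div_nonneg (Finset.sum_nonneg fun _ _ => by split_ifs <;> norm_num) (Nat.cast_nonneg _)

lemma sampleCost_nonneg (A B : Finset G) {a : ℝ} (ha : 0 ≤ a) (η : ℝ) {k : ℕ} (b : Fin k → G)
    (x : G) : 0 ≤ sampleCost A B a η b x := by
  have := convDens_nonneg A B x
  unfold sampleCost
  split_ifs <;> positivity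

lemma convDens_eq_zero {A B : Finset G} {x : G} (hx : x ∉ A + B) : convDens A B x = 0 := by
  unfold convDens
  rw [Finset.sum_eq_zero, zero_div]
  intro b hb
  rw [if_neg]
  intro h
  exact hx (by simpa using Finset.add_mem_add h hb)

lemma sampleDens_eq_zero {A B : Finset G} {k : ℕ} {b : Fin k → G} (hb : ∀ i, b i ∈ B) {x : G}
    (hx : x ∉ A + B) : sampleDens A b x = 0 := by
  unfold sampleDens
  rw [Finset.sum_eq_zero, zero_div]
  intro i _
  rw [if_neg]
  intro h
  exact hx (by simpa using Finset.add_mem_add h (hb i))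

lemma sampleCost_eq_zero {A B : Finset G} {a η : ℝ} (ha : 0 ≤ a) (hη : 0 ≤ η) {k : ℕ}
    {b : Fin k → G} (hb : ∀ i, b i ∈ B) {x : G} (hx : x ∉ A + B) :
    sampleCost A B a η b x = 0 := by
  unfold sampleCost
  rw [convDens_eq_zero hx, sampleDens_eq_zero hb hx, if_pos]
  simpa using mul_nonneg hη ha

lemma sampleDens_add_const (A : Finset G) {k : ℕ} (b : Fin k → G) (t x : G) :
    sampleDens A (fun i => b i + t) (x + t) = sampleDens A b x := by
  simp [sampleDens]

lemma sum_convDens {A B : Finset G} (hB : B.Nonempty) :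
    ∑ x ∈ A + B, convDens A B x = A.card := by
  have hB' : (B.card : ℝ) ≠ 0 := by exact_mod_cast hB.card_pos.ne'
  unfold convDens
  rw [← Finset.sum_div, Finset.sum_comm, div_eq_iff hB']
  have : ∀ b ∈ B, (∑ x ∈ A + B, if x - b ∈ A then (1 : ℝ) else 0) = A.card := by
    intro b hb
    rw [Finset.sum_boole]
    congr 1
    have : (A + B).filter (fun x => x - b ∈ A) = A.map (addRightEmbedding b) := by
      ext x
      simp only [Finset.mem_filter, Finset.mem_map, addRightEmbedding_apply]
      constructor
      · rintro ⟨_, h⟩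
        exact ⟨x - b, h, by simp⟩
      · rintro ⟨y, hy, rfl⟩
        exact ⟨Finset.add_mem_add hy hb, by simpa using hy⟩
    rw [this, Finset.card_map]
  rw [Finset.sum_congr rfl this]
  simp [mul_comm]

/-- Since e^s ≤ 1 + s + s², the variance proxy is μ itself; this is what makes an error relative to
μ + a affordable. -/
lemma sum_exp_indicator_le (A : Finset G) {B : Finset G} (hB : B.Nonempty) (x : G) {s : ℝ}
    (hs : |s| ≤ 1) :
    ∑ b ∈ B, Real.exp (s * ((if x - b ∈ A then (1 : ℝ) else 0) - convDens A B x))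
      ≤ B.card * Real.exp (convDens A B x * s ^ 2) := by
  have hB' : (0 : ℝ) < B.card := by exact_mod_cast hB.card_pos
  set μ := convDens A B x with hμ
  have hμ0 : 0 ≤ μ := convDens_nonneg A B x
  have hsum : ∑ b ∈ B, (if x - b ∈ A then (1 : ℝ) else 0) = B.card * μ := by
    rw [hμ, convDens]; field_simp
  have h1 : ∀ b ∈ B, Real.exp (s * ((if x - b ∈ A then (1 : ℝ) else 0) - μ))
      = Real.exp (-(s * μ)) + Real.exp (-(s * μ)) * (Real.exp s - 1) *
        (if x - b ∈ A then (1 : ℝ) else 0) := by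
    intro b _
    split_ifs
    · rw [show s * (1 - μ) = -(s * μ) + s by ring, Real.exp_add]; ring
    · simp
  rw [Finset.sum_congr rfl h1, Finset.sum_add_distrib, ← Finset.mul_sum, hsum]
  have h2 : Real.exp s - 1 ≤ s + s ^ 2 := by
    have := (abs_le.1 (Real.abs_exp_sub_one_sub_id_le hs)).2
    linarith
  have h3 : 1 + μ * (Real.exp s - 1) ≤ Real.exp (μ * (s + s ^ 2)) := by
    have := Real.add_one_le_exp (μ * (s + s ^ 2))
    have := mul_le_mul_of_nonneg_left h2 hμ0
    linarith
  calc _ = B.card * (Real.exp (-(s * μ)) * (1 + μ * (Real.exp s - 1))) := by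
        simp; ring
    _ ≤ B.card * (Real.exp (-(s * μ)) * Real.exp (μ * (s + s ^ 2))) := by gcongr
    _ = _ := by rw [← Real.exp_add]; ring_nf

lemma sum_exp_sampleDens_le (A : Finset G) {B : Finset G} (hB : B.Nonempty) (x : G) {s : ℝ}
    (hs : |s| ≤ 1) {k : ℕ} (hk : 0 < k) :
    ∑ b ∈ Fintype.piFinset (fun _ : Fin k => B),
        Real.exp (s * k * (sampleDens A b x - convDens A B x))
      ≤ (B.card : ℝ) ^ k * Real.exp (k * (convDens A B x * s ^ 2)) := by
  have hk' : (k : ℝ) ≠ 0 := by exact_mod_cast hk.ne'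
  have h1 : ∀ b : Fin k → G, Real.exp (s * k * (sampleDens A b x - convDens A B x))
      = ∏ i, Real.exp (s * ((if x - b i ∈ A then (1 : ℝ) else 0) - convDens A B x)) := by
    intro b
    rw [← Real.exp_sum, ← Finset.mul_sum, Finset.sum_sub_distrib, sampleDens]
    congr 1
    simp only [Finset.sum_const, Finset.card_univ, Fintype.card_fin, nsmul_eq_mul]
    field_simp
  rw [Finset.sum_congr rfl fun b _ => h1 b,
    ← Finset.prod_univ_sum (fun _ : Fin k => B)
      (fun _ c => Real.exp (s * ((if x - c ∈ A then (1 : ℝ) else 0) - convDens A B x))),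
    Finset.prod_const, Finset.card_univ, Fintype.card_fin, Real.exp_nat_mul, ← mul_pow]
  exact pow_le_pow_left₀ (Finset.sum_nonneg fun _ _ => (Real.exp_pos _).le)
    (sum_exp_indicator_le A hB x hs) k

/-- Pointwise exponential Markov with parameter η/2 and both signs. The hypothesis `hk` lets the
exponential absorb the linear size of the cost. -/
lemma sampleCost_le (A B : Finset G) {a η : ℝ} (ha : 0 < a) (hη : 0 ≤ η) (hη1 : η ≤ 1) {k : ℕ}
    (hk : 2 ≤ k * a * η) (b : Fin k → G) (x : G) :
    sampleCost A B a η b x ≤ 2 * (convDens A B x + a) *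
      Real.exp (-(η / 2 * k * (η * (convDens A B x + a)))) *
      (Real.exp (η / 2 * k * (sampleDens A b x - convDens A B x)) +
        Real.exp (-(η / 2) * k * (sampleDens A b x - convDens A B x))) := by
  have hμ := convDens_nonneg A B x
  set v := convDens A B x + a with hv
  have hv0 : 0 < v := by positivity
  set z := sampleDens A b x - convDens A B x with hz
  unfold sampleCost
  rw [← hz, ← hv]
  split_ifs with h
  · positivity
  · push Not at h
    have h1 : Real.exp (η / 2 * k * |z|) ≤
        Real.exp (η / 2 * k * z) + Real.exp (-(η / 2) * k * z) := by
      rcases abs_cases z with ⟨h, _⟩ | ⟨h, _⟩ <;> rw [h]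
      · exact le_add_of_nonneg_right (Real.exp_pos _).le
      · rw [show η / 2 * k * -z = -(η / 2) * k * z by ring]
        exact le_add_of_nonneg_left (Real.exp_pos _).le
    have h2 : (1 : ℝ) ≤ η / 2 * k * v := by
      have : η / 2 * k * a ≤ η / 2 * k * v := by
        gcongr; linarith
      linarith
    have h3 : v + |z| ≤ 2 * v * Real.exp (η / 2 * k * (|z| - η * v)) := by
      have e1 := Real.add_one_le_exp (η / 2 * k * (|z| - η * v))
      have e2 : (|z| - η * v) ≤ v * (η / 2 * k * (|z| - η * v)) := by
        have := mul_le_mul_of_nonneg_right h2 (sub_nonneg.2 h.le)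
        linarith
      have e3 : 0 ≤ η / 2 * k * (|z| - η * v) := by
        have := sub_nonneg.2 h.le
        positivity
      have e4 : η * v ≤ v := by nlinarith
      have e5 := mul_le_mul_of_nonneg_left e1 hv0.le
      have e6 := mul_nonneg hv0.le e3
      linarith
    calc v + |z| ≤ 2 * v * Real.exp (η / 2 * k * (|z| - η * v)) := h3
      _ = 2 * v * Real.exp (-(η / 2 * k * (η * v))) * Real.exp (η / 2 * k * |z|) := by
        rw [mul_assoc (2 * v), ← Real.exp_add]; ring_nf
      _ ≤ _ := by gcongr

lemma sum_sampleCost_le (A : Finset G) {B : Finset G} (hB : B.Nonempty) {a η : ℝ} (ha : 0 < a)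
    (hη : 0 ≤ η) (hη1 : η ≤ 1) {k : ℕ} (hk : 2 ≤ k * a * η) (x : G) :
    ∑ b ∈ Fintype.piFinset (fun _ : Fin k => B), sampleCost A B a η b x
      ≤ (B.card : ℝ) ^ k * (4 * Real.exp (-(k * a * η ^ 2 / 4))) * (convDens A B x + a) := by
  have hμ := convDens_nonneg A B x
  have hk0 : 0 < k := by
    rcases Nat.eq_zero_or_pos k with rfl | h
    · norm_num at hk
    · exact h
  have hs : |η / 2| ≤ 1 := by rw [abs_le]; constructor <;> linarith
  have hs' : |-(η / 2)| ≤ 1 := by rwa [abs_neg]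
  refine (Finset.sum_le_sum fun b _ => sampleCost_le A B ha hη hη1 hk b x).trans ?_
  rw [← Finset.mul_sum, Finset.sum_add_distrib]
  have h1 := sum_exp_sampleDens_le A hB x hs hk0
  have h2 := sum_exp_sampleDens_le A hB x hs' hk0
  rw [neg_sq] at h2
  set μ := convDens A B x with hμd
  calc _ ≤ 2 * (μ + a) * Real.exp (-(η / 2 * k * (η * (μ + a)))) *
        ((B.card : ℝ) ^ k * Real.exp (k * (μ * (η / 2) ^ 2)) +
          (B.card : ℝ) ^ k * Real.exp (k * (μ * (η / 2) ^ 2))) := by gcongr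
    _ = (B.card : ℝ) ^ k * (4 * Real.exp (-(η / 2 * k * (η * (μ + a))) +
          k * (μ * (η / 2) ^ 2))) * (μ + a) := by rw [Real.exp_add]; ring
    _ ≤ _ := by
      gcongr
      have : 0 ≤ k * η ^ 2 * (μ + a) := by positivity
      have : 0 ≤ k * η ^ 2 * μ := by positivity
      have : 0 ≤ k * η ^ 2 * a := by positivity
      nlinarith

/-- The samples from `B` whose total cost is at most `κ`. -/
noncomputable def goodSamples (A B : Finset G) (a η κ : ℝ) (k : ℕ) : Finset (Fin k → G) :=
  (Fintype.piFinset fun _ : Fin k => B).filter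
    fun b => ∑ x ∈ A + B, sampleCost A B a η b x ≤ κ

/-- Markov's inequality: the threshold is twice the bound on the mean total cost. -/
lemma card_goodSamples_ge {A B : Finset G} (hB : B.Nonempty) {a η : ℝ} (ha : 0 < a)
    (hη : 0 ≤ η) (hη1 : η ≤ 1) {k : ℕ} (hk : 2 ≤ k * a * η) :
    (B.card : ℝ) ^ k / 2 ≤ (goodSamples A B a η
      (8 * Real.exp (-(k * a * η ^ 2 / 4)) * ∑ x ∈ A + B, (convDens A B x + a)) k).card := by
  set V := ∑ x ∈ A + B, (convDens A B x + a) with hV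
  set ε := Real.exp (-(k * a * η ^ 2 / 4)) with hε
  set Ω := Fintype.piFinset fun _ : Fin k => B with hΩ
  have hV0 : 0 ≤ V := Finset.sum_nonneg fun x _ => add_nonneg (convDens_nonneg A B x) ha.le
  have hΩc : (Ω.card : ℝ) = (B.card : ℝ) ^ k := by simp [hΩ]
  have htot : ∑ b ∈ Ω, ∑ x ∈ A + B, sampleCost A B a η b x ≤ (B.card : ℝ) ^ k * (4 * ε) * V := by
    rw [Finset.sum_comm, hV, Finset.mul_sum]
    exact Finset.sum_le_sum fun x _ => sum_sampleCost_le A hB ha hη hη1 hk x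
  rcases hV0.eq_or_lt with h0 | hVpos
  · have : goodSamples A B a η (8 * ε * V) k = Ω := by
      refine Finset.filter_true_of_mem fun b hb => ?_
      rw [← h0, mul_zero] at htot ⊢
      exact (Finset.single_le_sum (f := fun b => ∑ x ∈ A + B, sampleCost A B a η b x)
        (fun b _ => Finset.sum_nonneg fun x _ => sampleCost_nonneg A B ha.le η b x) hb).trans htot
    rw [this, hΩc]
    have : (0 : ℝ) ≤ (B.card : ℝ) ^ k := by positivity
    linarith
  have hbad : ((Ω.filter fun b => ¬ ∑ x ∈ A + B, sampleCost A B a η b x ≤ 8 * ε * V).card : ℝ)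
      * (8 * ε * V) ≤ (B.card : ℝ) ^ k * (4 * ε) * V := by
    rw [← nsmul_eq_mul]
    refine (Finset.card_nsmul_le_sum _ (fun b => ∑ x ∈ A + B, sampleCost A B a η b x) _
      fun b hb => (not_le.1 (Finset.mem_filter.1 hb).2).le).trans (le_trans ?_ htot)
    exact Finset.sum_le_sum_of_subset_of_nonneg (Finset.filter_subset _ _)
      fun b _ _ => Finset.sum_nonneg fun x _ => sampleCost_nonneg A B ha.le η b x
  have hsplit := Finset.card_filter_add_card_filter_not (s := Ω)
    (fun b => ∑ x ∈ A + B, sampleCost A B a η b x ≤ 8 * ε * V)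
  have hsplit' : ((goodSamples A B a η (8 * ε * V) k).card : ℝ) +
      (Ω.filter fun b => ¬ ∑ x ∈ A + B, sampleCost A B a η b x ≤ 8 * ε * V).card
        = (B.card : ℝ) ^ k := by
    rw [← hΩc, ← hsplit]; push_cast; rfl
  have hεpos : 0 < ε := Real.exp_pos _
  have : ((Ω.filter fun b => ¬ ∑ x ∈ A + B, sampleCost A B a η b x ≤ 8 * ε * V).card : ℝ)
      ≤ (B.card : ℝ) ^ k / 2 := by
    have h8 : 0 < 8 * ε * V := by positivity
    refine le_of_mul_le_mul_right (hbad.trans (le_of_eq ?_)) h8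
    ring
  linarith

end AlmostPeriods

/-! ### Chaining almost-periods along binary digits. -/

section Chains

variable {G : Type*} [AddCommGroup G] [DecidableEq G]

lemma abs_sampleDens_sub_le_of_sampleCost_lt {A B : Finset G} {a η : ℝ} {k : ℕ}
    {b : Fin k → G} {x : G}
    (h : sampleCost A B a η b x < convDens A B x + a + |sampleDens A b x - convDens A B x|) :
    |sampleDens A b x - convDens A B x| ≤ η * (convDens A B x + a) := by
  by_contra hn
  rw [sampleCost, if_neg hn] at h
  exact lt_irrefl _ h

/-- If a sample and its translate by `t` both have low cost, at `x` and `x + t` respectively, then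
`convDens` does not drop much from `x` to `x + t`. -/
lemma convDens_add_ge {A B : Finset G} {a η w : ℝ} (ha : 0 ≤ a) (hη : 0 ≤ η) {k : ℕ}
    {b : Fin k → G} {x t : G} (hx : sampleCost A B a η b x < w)
    (hxt : sampleCost A B a η (fun i => b i + t) (x + t) < w)
    (hw : w ≤ (1 - η) * (convDens A B x + a)) :
    (1 - 2 * η) * (convDens A B x + a) ≤ convDens A B (x + t) + a := by
  have hμ := convDens_nonneg A B x
  have hμ' := convDens_nonneg A B (x + t)
  have hwv : w ≤ convDens A B x + a := hw.trans (by nlinarith)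
  have h1 := abs_sampleDens_sub_le_of_sampleCost_lt
    (hx.trans_le (hwv.trans (le_add_of_nonneg_right (abs_nonneg _))))
  have hY : (1 - η) * (convDens A B x + a) ≤ sampleDens A b x + a := by
    have := (abs_le.1 h1).1
    linarith
  -- Nothing is known yet about μ at `x + t`, but a bad point there would cost at least the sample
  -- value plus `a`, and that value is carried over from `x`. The absolute value in the cost serves
  -- this purpose.
  have h2 := abs_sampleDens_sub_le_of_sampleCost_lt (hxt.trans_le (hw.trans (hY.trans (by
    have := le_abs_self
      (sampleDens A (fun i => b i + t) (x + t) - convDens A B (x + t))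
    rw [sampleDens_add_const] at this ⊢
    linarith))))
  rw [sampleDens_add_const] at h2
  have h3 := (abs_le.1 h2).2
  have h4 : (1 - η) * (convDens A B x + a) ≤ (1 + η) * (convDens A B (x + t) + a) := by linarith
  rcases le_total ((1 - 2 * η) * (convDens A B x + a)) 0 with h0 | h0
  · linarith
  · have h5 : (1 + η) * ((1 - 2 * η) * (convDens A B x + a)) ≤
        (1 + η) * (convDens A B (x + t) + a) := by
      refine le_trans ?_ h4
      have : 0 ≤ η ^ 2 * (convDens A B x + a) := by positivity
      nlinarith
    exact le_of_mul_le_mul_left h5 (by linarith)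

/-- The total cost met on the way from `x` to `x + i • D` when the binary digits of `i` are added
one by one. -/
noncomputable def pathCost (A B : Finset G) (a η : ℝ) {k : ℕ} (g : ℕ → Fin k → G) (D : G)
    (J i : ℕ) (x : G) : ℝ :=
  ∑ j ∈ Finset.range J, (sampleCost A B a η (g j) (x + (i % 2 ^ j) • D) +
    sampleCost A B a η (fun l => g j l + 2 ^ j • D) (x + (i % 2 ^ (j + 1)) • D))

lemma pathCost_nonneg (A B : Finset G) {a : ℝ} (ha : 0 ≤ a) (η : ℝ) {k : ℕ}
    (g : ℕ → Fin k → G) (D : G) (J i : ℕ) (x : G) : 0 ≤ pathCost A B a η g D J i x :=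
  Finset.sum_nonneg fun _ _ =>
    add_nonneg (sampleCost_nonneg A B ha η _ _) (sampleCost_nonneg A B ha η _ _)

lemma convDens_path_ge {A B : Finset G} {a η : ℝ} (ha : 0 ≤ a) (hη : 0 ≤ η) {k : ℕ}
    {g : ℕ → Fin k → G} {D : G} {J i : ℕ} (hJ : 8 * η * J ≤ 1) {x : G}
    (hx : pathCost A B a η g D J i x < (convDens A B x + a) / 2) :
    ∀ j ≤ J, (1 - 2 * η * j) * (convDens A B x + a) ≤
      convDens A B (x + (i % 2 ^ j) • D) + a := by
  have hv : 0 ≤ convDens A B x + a := add_nonneg (convDens_nonneg A B x) ha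
  intro j
  induction j with
  | zero => intro _; simp [Nat.mod_one]
  | succ j ih =>
    intro hj
    have hjJ : ((j : ℝ) + 1) ≤ J := by exact_mod_cast hj
    have hηj : 8 * (η * (j + 1)) ≤ 1 := by
      have := mul_le_mul_of_nonneg_left hjJ hη
      linarith
    have hηj0 : 0 ≤ η * j := by positivity
    have ih' := ih (by omega)
    have hterm := (Finset.single_le_sum (f := fun j =>
      sampleCost A B a η (g j) (x + (i % 2 ^ j) • D) +
        sampleCost A B a η (fun l => g j l + 2 ^ j • D) (x + (i % 2 ^ (j + 1)) • D))
      (fun _ _ => add_nonneg (sampleCost_nonneg A B ha η _ _) (sampleCost_nonneg A B ha η _ _))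
      (Finset.mem_range.2 hj)).trans_lt hx
    have hc1 := sampleCost_nonneg A B ha η (g j) (x + (i % 2 ^ j) • D)
    have hc2 := sampleCost_nonneg A B ha η (fun l => g j l + 2 ^ j • D)
      (x + (i % 2 ^ (j + 1)) • D)
    set u := convDens A B (x + (i % 2 ^ j) • D) + a with hu
    set v := convDens A B x + a with hvd
    -- At most a quarter is lost in all, so the threshold v/2 remains below (1 - η)u.
    have hlow : 3 / 4 * v ≤ u := by
      refine le_trans ?_ ih'
      gcongr
      linarith
    have hmod : i % 2 ^ (j + 1) = i % 2 ^ j + 2 ^ j * (i.testBit j).toNat := by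
      rw [Nat.mod_pow_succ, Nat.toNat_testBit]
    cases hbit : i.testBit j with
    | false =>
      rw [hbit] at hmod
      simp only [Bool.toNat_false, mul_zero, add_zero] at hmod
      rw [hmod]
      refine le_trans ?_ ih'
      gcongr
      exact Nat.le_succ j
    | true =>
      rw [hbit] at hmod
      simp only [Bool.toNat_true, mul_one] at hmod
      rw [hmod, add_smul, ← add_assoc] at hterm hc2 ⊢
      have hstep := convDens_add_ge (A := A) (B := B) (w := v / 2) ha hη (b := g j) (x := x + (i % 2 ^ j) • D)
        (t := 2 ^ j • D) (by linarith) (by linarith) (by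
          rw [← hu]
          have : (7 / 8 : ℝ) * u ≤ (1 - η) * u := by
            gcongr
            · linarith
            · linarith
          linarith)
      rw [← hu] at hstep
      refine le_trans ?_ hstep
      have h1 : (1 - 2 * η) * ((1 - 2 * η * j) * v) ≤ (1 - 2 * η) * u := by
        gcongr
        linarith
      refine le_trans ?_ h1
      have : 0 ≤ η * (η * j) * v := by positivity
      push_cast
      nlinarith

/-- The cost vanishes off A + B, so shifting the points cannot raise the total. -/
lemma sum_sampleCost_add_le {A B : Finset G} {a η : ℝ} (ha : 0 ≤ a) (hη : 0 ≤ η) {k : ℕ}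
    {b : Fin k → G} (hb : ∀ i, b i ∈ B) (S : Finset G) (t : G) :
    ∑ x ∈ S, sampleCost A B a η b (x + t) ≤ ∑ x ∈ A + B, sampleCost A B a η b x := by
  have h1 : ∑ x ∈ S, sampleCost A B a η b (x + t)
      = ∑ x ∈ S.map (addRightEmbedding t), sampleCost A B a η b x := by
    rw [Finset.sum_map]; rfl
  rw [h1, ← Finset.sum_filter_of_ne (p := fun x => x ∈ A + B)
    (fun x _ hx => by_contra fun h => hx (sampleCost_eq_zero ha hη hb h))]
  exact Finset.sum_le_sum_of_subset_of_nonneg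
    (fun x hx => (Finset.mem_filter.1 hx).2) fun x _ _ => sampleCost_nonneg A B ha η b x

/-- If the translates of good samples by `2 ^ j • D` are again good for all `j < J`, then `A + B`
contains a progression with difference `D` and `2 ^ J` terms. -/
lemma exists_forall_add_smul_mem {A B : Finset G} (hA : A.Nonempty) (hB : B.Nonempty)
    {a η κ : ℝ} (ha : a = A.card / (A + B).card) (hη : 0 ≤ η) {k J : ℕ} (hJ : 8 * η * J ≤ 1)
    {g : ℕ → Fin k → G} {D : G} (hg : ∀ j < J, g j ∈ goodSamples A B a η κ k)
    (hg' : ∀ j < J, (fun l => g j l + 2 ^ j • D) ∈ goodSamples A B a η κ k)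
    (hκ : 2 ^ J * (J * (2 * κ)) < (A.card : ℝ) / 4) :
    ∃ x, ∀ i < 2 ^ J, x + i • D ∈ A + B := by
  have hn : (0 : ℝ) < (A + B).card := by exact_mod_cast (hA.add hB).card_pos
  have hAc : (0 : ℝ) < A.card := by exact_mod_cast hA.card_pos
  have ha0 : 0 < a := by rw [ha]; positivity
  have han : a * (A + B).card = A.card := by rw [ha]; field_simp
  -- For such points 3/4 of μ + a is at least 9a/8 > a, which forces μ > 0 at the end of each path;
  -- they still carry half the mass of μ.
  set S := (A + B).filter fun x => a / 2 ≤ convDens A B x with hS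
  have hSsum : (A.card : ℝ) / 2 ≤ ∑ x ∈ S, (convDens A B x + a) := by
    have h1 := Finset.sum_filter_add_sum_filter_not (A + B) (fun x => a / 2 ≤ convDens A B x)
      (fun x => convDens A B x)
    rw [sum_convDens hB] at h1
    have h2 : ∑ x ∈ (A + B).filter (fun x => ¬ a / 2 ≤ convDens A B x), convDens A B x
        ≤ (A + B).card * (a / 2) := by
      refine (Finset.sum_le_card_nsmul _ _ (a / 2)
        fun x hx => (not_le.1 (Finset.mem_filter.1 hx).2).le).trans ?_
      rw [nsmul_eq_mul]
      gcongr
      exact Finset.filter_subset _ _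
    have h3 : ∑ x ∈ S, convDens A B x ≤ ∑ x ∈ S, (convDens A B x + a) :=
      Finset.sum_le_sum fun x _ => by linarith
    linarith
  have hmem : ∀ {b : Fin k → G}, b ∈ goodSamples A B a η κ k →
      (∀ i, b i ∈ B) ∧ ∑ x ∈ A + B, sampleCost A B a η b x ≤ κ := by
    intro b hb
    simpa [goodSamples] using hb
  have hcost : ∑ x ∈ S, ∑ i ∈ Finset.range (2 ^ J), pathCost A B a η g D J i x
      ≤ 2 ^ J * (J * (2 * κ)) := by
    rw [Finset.sum_comm]
    have hi : ∀ i ∈ Finset.range (2 ^ J),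
        ∑ x ∈ S, pathCost A B a η g D J i x ≤ J * (2 * κ) := by
      intro i _
      unfold pathCost
      rw [Finset.sum_comm]
      have hj : ∀ j ∈ Finset.range J, ∑ x ∈ S, (sampleCost A B a η (g j) (x + (i % 2 ^ j) • D) +
          sampleCost A B a η (fun l => g j l + 2 ^ j • D) (x + (i % 2 ^ (j + 1)) • D))
            ≤ 2 * κ := by
        intro j hj
        have hjJ := Finset.mem_range.1 hj
        obtain ⟨p1, q1⟩ := hmem (hg j hjJ)
        obtain ⟨p2, q2⟩ := hmem (hg' j hjJ)
        rw [Finset.sum_add_distrib]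
        have r1 := sum_sampleCost_add_le (A := A) ha0.le hη p1 S ((i % 2 ^ j) • D)
        have r2 := sum_sampleCost_add_le (A := A) ha0.le hη p2 S ((i % 2 ^ (j + 1)) • D)
        linarith
      simpa using Finset.sum_le_card_nsmul _ _ _ hj
    simpa using Finset.sum_le_card_nsmul _ _ _ hi
  obtain ⟨x, hxS, hx⟩ : ∃ x ∈ S, ∑ i ∈ Finset.range (2 ^ J), pathCost A B a η g D J i x
      < (convDens A B x + a) / 2 := by
    by_contra! h
    have := Finset.sum_le_sum h
    rw [← Finset.sum_div] at this
    linarith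
  refine ⟨x, fun i hi => ?_⟩
  have hxi := (Finset.single_le_sum (f := fun i => pathCost A B a η g D J i x)
    (fun i _ => pathCost_nonneg A B ha0.le η g D J i x) (Finset.mem_range.2 hi)).trans_lt hx
  have hend := convDens_path_ge ha0.le hη hJ hxi J le_rfl
  rw [Nat.mod_eq_of_lt hi] at hend
  have hxa : a / 2 ≤ convDens A B x := (Finset.mem_filter.1 hxS).2
  by_contra hnot
  rw [convDens_eq_zero hnot] at hend
  have : (3 / 4 : ℝ) * (convDens A B x + a) ≤ (1 - 2 * η * J) * (convDens A B x + a) := by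
    exact mul_le_mul_of_nonneg_right (by linarith) (by linarith)
  linarith

end Chains

/-! ### Pigeonhole for the common difference, and choice of parameters. -/

lemma exists_translates_mem {N k J M : ℕ} (S : Finset (Fin k → ℤ))
    (hS : ∀ b ∈ S, ∀ i, b i ∈ Finset.Icc 1 (N : ℤ)) (hM : 2 ^ J * M ≤ N)
    (hcard : ((2 * N) ^ k) ^ J < M * S.card ^ J) :
    ∃ D : ℤ, D ≠ 0 ∧ ∃ g : ℕ → Fin k → ℤ, ∀ j < J,
      g j ∈ S ∧ (fun l => g j l + 2 ^ j • D) ∈ S := by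
  set T := Fintype.piFinset fun _ : Fin J => Fintype.piFinset fun _ : Fin k =>
    Finset.Icc (1 : ℤ) (2 * N) with hT
  set Q := Finset.range M ×ˢ Fintype.piFinset fun _ : Fin J => S with hQ
  have hTc : T.card = ((2 * N) ^ k) ^ J := by
    have : (2 * N : ℤ).toNat = 2 * N := by omega
    simp [hT, this]
  have hQc : Q.card = M * S.card ^ J := by simp [hQ]
  -- A collision says that D = d - d' carries `g` to `g'` at every scale 2^j simultaneously.
  obtain ⟨⟨d, g⟩, h1, ⟨d', g'⟩, h2, hne, heq⟩ := Finset.exists_ne_map_eq_of_card_lt_of_maps_to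
    (s := Q) (t := T) (by rw [hTc, hQc]; exact hcard)
    (f := fun p j l => p.2 j l + 2 ^ (j : ℕ) * (p.1 : ℤ)) (by
      rintro ⟨d, g⟩ hp
      simp only [hQ, Finset.coe_product, Set.mem_prod, Finset.mem_coe, Finset.mem_range,
        Fintype.mem_piFinset] at hp
      simp only [hT, Finset.mem_coe, Fintype.mem_piFinset]
      intro j l
      have hgl := Finset.mem_Icc.1 (hS _ (hp.2 j) l)
      have hle : 2 ^ (j : ℕ) * d ≤ N :=
        le_trans (Nat.mul_le_mul (Nat.pow_le_pow_right two_pos j.2.le) hp.1.le) hM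
      have hle' : (2 : ℤ) ^ (j : ℕ) * d ≤ N := by exact_mod_cast hle
      have h0 : (0 : ℤ) ≤ 2 ^ (j : ℕ) * d := by positivity
      rw [Finset.mem_Icc]
      constructor <;> linarith)
  simp only [hQ, Finset.mem_product, Fintype.mem_piFinset] at h1 h2
  have hpt : ∀ j l, g j l + 2 ^ (j : ℕ) * (d : ℤ) = g' j l + 2 ^ (j : ℕ) * (d' : ℤ) :=
    fun j l => congrFun (congrFun heq j) l
  refine ⟨(d : ℤ) - d', ?_, fun j => if h : j < J then g ⟨j, h⟩ else 0, fun j hj => ?_⟩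
  · intro h0
    have hd : d = d' := by omega
    subst hd
    refine hne (Prod.ext rfl ?_)
    funext j l
    simpa using hpt j l
  · simp only [hj, dif_pos]
    refine ⟨h1.2 _, ?_⟩
    convert h2.2 ⟨j, hj⟩ using 1
    funext l
    have := hpt ⟨j, hj⟩ l
    simp only [nsmul_eq_mul, Nat.cast_pow, Nat.cast_ofNat] at this ⊢
    linarith

lemma exists_progression_of_log_ge {N : ℕ} (hN : 0 < N) {A B : Finset ℤ}
    (hAN : A ⊆ Finset.Icc 1 (N : ℤ)) (hBN : B ⊆ Finset.Icc 1 (N : ℤ)) (hA : A.Nonempty)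
    (hB : B.Nonempty) {α β : ℝ} (hα : (A.card : ℝ) = α * N) (hβ : (B.card : ℝ) = β * N)
    (hα0 : 0 < α) (hα1 : α ≤ 1) (hβ0 : 0 < β) (hβ1 : β ≤ 1) {J : ℕ} (hJ : 0 < J)
    (hlog : 20736 * J ^ 4 / α * Real.log (4 / β) ≤ Real.log N) :
    ∃ x D : ℤ, D ≠ 0 ∧ ∀ i < 2 ^ J, x + i • D ∈ A + B := by
  have hN' : (0 : ℝ) < N := by exact_mod_cast hN
  have hJ1 : (1 : ℝ) ≤ J := by exact_mod_cast hJ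
  have hJ0 : (0 : ℝ) < J := by positivity
  have hAc : (0 : ℝ) < A.card := by exact_mod_cast hA.card_pos
  have hn : (0 : ℝ) < (A + B).card := by exact_mod_cast (hA.add hB).card_pos
  have hcardle : ((A + B).card : ℝ) ≤ 2 * N := by
    have hsub : A + B ⊆ Finset.Icc 1 (2 * N : ℤ) := by
      intro x hx
      obtain ⟨y, hy, z, hz, rfl⟩ := Finset.mem_add.1 hx
      have h1 := Finset.mem_Icc.1 (hAN hy)
      have h2 := Finset.mem_Icc.1 (hBN hz)
      rw [Finset.mem_Icc]
      omega
    have := Finset.card_le_card hsub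
    rw [Int.card_Icc] at this
    have h2 : (A + B).card ≤ 2 * N := by omega
    exact_mod_cast h2
  set a : ℝ := A.card / (A + B).card with ha
  have hahalf : α / 2 ≤ a := by
    rw [ha, hα, le_div_iff₀ hn]
    have := mul_le_mul_of_nonneg_left hcardle (half_pos hα0).le
    linarith
  have ha0 : 0 < a := by linarith
  -- Here 5120 = 10·4·8²·2: with a ≥ α/2 and η = 1/(8J) the exponent kaη²/4 is at least 10J, which
  -- beats the 2^J paths.
  set k : ℕ := ⌈5120 * (J : ℝ) ^ 3 / α⌉₊ with hk
  have hk1 : 5120 * (J : ℝ) ^ 3 / α ≤ k := Nat.le_ceil _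
  have hk2 : (k : ℝ) < 5120 * (J : ℝ) ^ 3 / α + 1 := Nat.ceil_lt_add_one (by positivity)
  have hk0 : 0 < k := Nat.ceil_pos.2 (by positivity)
  have hka : 2560 * (J : ℝ) ^ 3 ≤ k * a := by
    calc 2560 * (J : ℝ) ^ 3 = 5120 * (J : ℝ) ^ 3 / α * (α / 2) := by field_simp; norm_num
      _ ≤ k * a := by gcongr
  set η : ℝ := 1 / (8 * J) with hη
  have hη0 : 0 ≤ η := by positivity
  have hη1 : η ≤ 1 := by
    rw [hη, div_le_one (by positivity)]; linarith
  have hJη : 8 * η * J ≤ 1 := by rw [hη]; exact le_of_eq (by field_simp)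
  have hkη : 2 ≤ k * a * η := by
    calc (2 : ℝ) ≤ 320 * 1 ^ 2 := by norm_num
      _ ≤ 320 * (J : ℝ) ^ 2 := by gcongr
      _ = 2560 * (J : ℝ) ^ 3 * η := by rw [hη]; field_simp; norm_num
      _ ≤ _ := by gcongr
  have hexp : 10 * (J : ℝ) ≤ k * a * η ^ 2 / 4 := by
    calc 10 * (J : ℝ) = 2560 * (J : ℝ) ^ 3 * η ^ 2 / 4 := by rw [hη]; field_simp; norm_num
      _ ≤ _ := by gcongr
  have hV : ∑ x ∈ A + B, (convDens A B x + a) = 2 * A.card := by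
    rw [Finset.sum_add_distrib, sum_convDens hB, Finset.sum_const, nsmul_eq_mul, ha]
    field_simp
    norm_num
  have hgood := card_goodSamples_ge (A := A) hB ha0 hη0 hη1 hkη
  rw [hV] at hgood
  set κ : ℝ := 8 * Real.exp (-(k * a * η ^ 2 / 4)) * (2 * A.card) with hκ
  have hκ' : 2 ^ J * (J * (2 * κ)) < (A.card : ℝ) / 4 := by
    have h1 : (128 : ℝ) * (2 ^ J * J) < Real.exp (10 * J) := by
      have h2 : (2 : ℝ) ^ (10 * J) ≤ Real.exp (10 * J) := by
        have : (2 : ℝ) ≤ Real.exp 1 := by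
          have := Real.add_one_le_exp (1 : ℝ); linarith
        calc (2 : ℝ) ^ (10 * J) ≤ Real.exp 1 ^ (10 * J) := by gcongr
          _ = Real.exp (10 * J) := by rw [← Real.exp_nat_mul]; push_cast; ring_nf
      have h3 : (J : ℝ) < 2 ^ J := by exact_mod_cast Nat.lt_two_pow_self
      calc (128 : ℝ) * (2 ^ J * J) < 128 * (2 ^ J * 2 ^ J) := by gcongr
        _ = 2 ^ (7 + J + J) := by ring
        _ ≤ 2 ^ (10 * J) := pow_le_pow_right₀ (by norm_num) (by omega)
        _ ≤ _ := h2
    have h4 : Real.exp (-(k * a * η ^ 2 / 4)) ≤ Real.exp (-(10 * J)) :=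
      Real.exp_le_exp.2 (by linarith)
    have h5 : Real.exp (10 * J) * Real.exp (-(10 * (J : ℝ))) = 1 := by
      rw [← Real.exp_add, add_neg_cancel, Real.exp_zero]
    have hp := Real.exp_pos (-(10 * (J : ℝ)))
    have h6 := mul_lt_mul_of_pos_right h1 hp
    rw [h5] at h6
    calc 2 ^ J * (J * (2 * κ))
        = (128 * (2 ^ J * J) * Real.exp (-(k * a * η ^ 2 / 4))) * (A.card / 4) := by
          rw [hκ]; ring
      _ ≤ (128 * (2 ^ J * J) * Real.exp (-(10 * J))) * (A.card / 4) := by gcongr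
      _ < 1 * (A.card / 4) := by gcongr
      _ = _ := one_mul _
  set S := goodSamples A B a η κ k with hS
  set M : ℕ := N / 2 ^ J with hMdef
  have hS1 : ∀ b ∈ S, ∀ i, b i ∈ Finset.Icc 1 (N : ℤ) := by
    intro b hb i
    exact hBN (Fintype.mem_piFinset.1 (Finset.mem_filter.1 hb).1 i)
  have hM1 : 2 ^ J * M ≤ N := Nat.mul_div_le N (2 ^ J)
  have hβ4 : (4 : ℝ) ≤ 4 / β := by
    rw [le_div_iff₀ hβ0]; linarith
  have hβ4' : (0 : ℝ) < 4 / β := by linarith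
  -- Of the spare exponent 2J, one J pays for the 2^J in `M` and the other for rounding down.
  have hNbig : (4 / β) ^ (k * J + 2 * J) ≤ (N : ℝ) := by
    rw [← Real.log_le_log_iff (by positivity) hN', Real.log_pow]
    refine le_trans ?_ hlog
    have hl : 0 ≤ Real.log (4 / β) := Real.log_nonneg (by linarith)
    gcongr
    push_cast
    have e1 : (J : ℝ) ≤ (J : ℝ) ^ 4 / α := by
      rw [le_div_iff₀ hα0]
      calc (J : ℝ) * α ≤ J * 1 := by gcongr
        _ ≤ J * J ^ 3 := by gcongr; exact one_le_pow₀ hJ1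
        _ = J ^ 4 := by ring
    have e2 : (k : ℝ) * J ≤ (5120 * (J : ℝ) ^ 3 / α + 1) * J := by gcongr
    have e3 : (5120 * (J : ℝ) ^ 3 / α + 1) * J = 5120 * (J ^ 4 / α) + J := by ring
    have e4 : 20736 * (J : ℝ) ^ 4 / α = 20736 * (J ^ 4 / α) := by ring
    rw [e4]
    linarith
  have hMbig : (4 / β) ^ (k * J) < (M : ℝ) := by
    have h1 : (N : ℝ) < 2 ^ J * (M + 1) := by
      have := Nat.lt_mul_div_succ N (pow_pos two_pos J)
      exact_mod_cast this
    have h2 : (2 : ℝ) ^ J ≤ (4 / β) ^ J := by gcongr; linarith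
    have h3 : (4 : ℝ) ≤ (4 / β) ^ J :=
      hβ4.trans (le_self_pow₀ (by linarith) hJ.ne')
    have h4 : (1 : ℝ) ≤ (4 / β) ^ (k * J) := one_le_pow₀ (by linarith)
    have h5 : (2 : ℝ) ^ J * ((4 / β) ^ (k * J) * 4) ≤ N := by
      calc (2 : ℝ) ^ J * ((4 / β) ^ (k * J) * 4)
          ≤ (4 / β) ^ J * ((4 / β) ^ (k * J) * (4 / β) ^ J) := by gcongr
        _ = (4 / β) ^ (k * J + 2 * J) := by ring
        _ ≤ N := hNbig
    have h6 := lt_of_mul_lt_mul_left (h5.trans_lt h1) (by positivity)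
    linarith
  -- Using 4/β in place of 2/β gains 2^k, which covers the half of the samples that may be bad.
  have hcard : ((2 * N) ^ k) ^ J < M * S.card ^ J := by
    have h1 : (2 * (N : ℝ)) ^ k ≤ (4 / β) ^ k * ((B.card : ℝ) ^ k / 2) := by
      rw [hβ]
      have : (4 / β) ^ k * ((β * N) ^ k / 2) = (2 * (N : ℝ)) ^ k * (2 ^ k / 2) := by
        rw [← mul_div_assoc, ← mul_div_assoc, ← mul_pow, ← mul_pow]
        congr 2
        field_simp
        norm_num
      rw [this]
      refine le_mul_of_one_le_right (by positivity) ?_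
      rw [le_div_iff₀ two_pos, one_mul]
      exact le_self_pow₀ (by norm_num) hk0.ne'
    have hBc : (0 : ℝ) < B.card := by exact_mod_cast hB.card_pos
    have h2 : ((2 * (N : ℝ)) ^ k) ^ J < M * (S.card : ℝ) ^ J := by
      have hSpos : (0 : ℝ) < S.card := lt_of_lt_of_le (by positivity) hgood
      calc ((2 * (N : ℝ)) ^ k) ^ J ≤ ((4 / β) ^ k * S.card) ^ J := by
            gcongr
            exact h1.trans (by gcongr)
        _ = (4 / β) ^ (k * J) * (S.card : ℝ) ^ J := by rw [mul_pow, pow_mul]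
        _ < _ := by gcongr
    exact_mod_cast h2
  obtain ⟨D, hD, g, hg⟩ := exists_translates_mem S hS1 hM1 hcard
  obtain ⟨x, hx⟩ := exists_forall_add_smul_mem hA hB ha hη0 hJη
    (fun j hj => (hg j hj).1) (fun j hj => by simpa using (hg j hj).2) hκ'
  exact ⟨x, D, hD, hx⟩

theorem theorem1p8 :
    ∃ c : ℝ, 0 < c ∧
      ∀ (N : ℕ), 0 < N →
      ∀ (A B : Finset ℤ), A ⊆ Finset.Icc 1 (N : ℤ) → B ⊆ Finset.Icc 1 (N : ℤ) →
        A.Nonempty → B.Nonempty →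
      ∀ (α β : ℝ), (A.card : ℝ) = α * (N : ℝ) → (B.card : ℝ) = β * (N : ℝ) →
      ∃ (k : ℕ) (P : Set ℤ), IsArithProgOfLength P k ∧ P ⊆ ((A + B : Finset ℤ) : Set ℤ) ∧
        (1 / 2 : ℝ) * Real.exp (c * (α * Real.log (N : ℝ) / Real.log (4 / β)) ^ (1 / 4 : ℝ))
          ≤ (k : ℝ) := by
  -- With J = ⌊R⌋ and 12⁴ = 20736, the constant makes the exponential equal to 2^R; the factor 1/2
  -- absorbs the floor.
  refine ⟨Real.log 2 / 12, by positivity, ?_⟩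
  intro N hN A B hAN hBN hA hB α β hα hβ
  have hN' : (0 : ℝ) < N := by exact_mod_cast hN
  have hdens : ∀ {C : Finset ℤ} {γ : ℝ}, C ⊆ Finset.Icc 1 (N : ℤ) → C.Nonempty →
      (C.card : ℝ) = γ * N → 0 < γ ∧ γ ≤ 1 := by
    intro C γ hC hne hγ
    have h1 : (0 : ℝ) < C.card := by exact_mod_cast hne.card_pos
    have h2 : (C.card : ℝ) ≤ N := by
      have := Finset.card_le_card hC
      rw [Int.card_Icc] at this
      have h3 : C.card ≤ N := by omega
      exact_mod_cast h3
    rw [hγ] at h1 h2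
    exact ⟨pos_of_mul_pos_left h1 hN'.le, by nlinarith⟩
  obtain ⟨hα0, hα1⟩ := hdens hAN hA hα
  obtain ⟨hβ0, hβ1⟩ := hdens hBN hB hβ
  have hl : 0 < Real.log (4 / β) := Real.log_pos (by rw [lt_div_iff₀ hβ0]; linarith)
  have hlN : 0 ≤ Real.log N := Real.log_nonneg (by exact_mod_cast hN)
  set X : ℝ := α * Real.log N / Real.log (4 / β) with hX
  have hX0 : 0 ≤ X := by positivity
  set R : ℝ := X ^ (1 / 4 : ℝ) / 12 with hR
  have hR0 : 0 ≤ R := by positivity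
  have hRX : 20736 * R ^ 4 = X := by
    rw [hR, div_pow, ← Real.rpow_natCast (X ^ (1 / 4 : ℝ)) 4, ← Real.rpow_mul hX0]
    norm_num
    ring
  have hbound : (1 / 2 : ℝ) * Real.exp (Real.log 2 / 12 * X ^ (1 / 4 : ℝ)) ≤
      ((2 ^ ⌊R⌋₊ : ℕ) : ℝ) := by
    have h1 := Nat.lt_floor_add_one R
    have h2 : Real.exp (Real.log 2 / 12 * X ^ (1 / 4 : ℝ)) = (2 : ℝ) ^ R := by
      rw [Real.rpow_def_of_pos two_pos, hR]; ring_nf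
    have h3 : (2 : ℝ) ^ R ≤ 2 ^ (⌊R⌋₊ + 1) := by
      rw [← Real.rpow_natCast]
      exact Real.rpow_le_rpow_of_exponent_le (by norm_num) (by push_cast; exact h1.le)
    rw [h2]
    push_cast
    rw [pow_succ] at h3
    linarith
  obtain ⟨x, D, hD, hx⟩ : ∃ x D : ℤ, D ≠ 0 ∧ ∀ i < 2 ^ ⌊R⌋₊, x + i • D ∈ A + B := by
    rcases Nat.eq_zero_or_pos ⌊R⌋₊ with h0 | hpos
    · obtain ⟨x, hx⟩ := hA.add hB
      refine ⟨x, 1, one_ne_zero, fun i hi => ?_⟩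
      rw [h0, pow_zero, Nat.lt_one_iff] at hi
      simpa [hi] using hx
    · refine exists_progression_of_log_ge hN hAN hBN hA hB hα hβ hα0 hα1 hβ0 hβ1 hpos ?_
      have h1 : (⌊R⌋₊ : ℝ) ^ 4 ≤ R ^ 4 := by
        gcongr
        exact Nat.floor_le hR0
      calc 20736 * (⌊R⌋₊ : ℝ) ^ 4 / α * Real.log (4 / β)
          ≤ 20736 * R ^ 4 / α * Real.log (4 / β) := by gcongr
        _ = Real.log N := by rw [hRX, hX]; field_simp
  refine ⟨2 ^ ⌊R⌋₊, {y | ∃ i : ℕ, i < 2 ^ ⌊R⌋₊ ∧ y = x + i • D}, ⟨x, D, hD, rfl⟩, ?_, hbound⟩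
  rintro y ⟨i, hi, rfl⟩
  exact hx i hi
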